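/- Let $T$ be a locally finite tree (a connected graph without cycles) rooted at a vertex $o$ which has exactly one neighbour; $T$ may have leaves. Every edge $\alpha$ is oriented away from $o$, with beginning vertex $b(\alpha)$ and ending vertex $e(\alpha)$. Let $\partial T$ be the set of half-infinite geodesics starting at $o$, together with the leaves. For a vertex or boundary point $x$ let $P(x)$ be the set of edges of the geodesic from $o$ to $x$, and for edges write $\alpha\le\beta$ if $\alpha\in P(e(\beta))$. For an edge $\alpha$, the tent $T_\alpha$ is the tree with edges $\{\beta:\beta\ge\alpha\}$, root vertex $b(\alpha)$ and boundary $\partial T_\alpha=\{\zeta\in\partial T:\alpha\in P(\zeta)\}$. The sets $\partial T_\alpha$ form a basis of the topology of $\partial T$. Fix $1<p<\infty$ and $1/p+1/p'=1$. For $f\ge 0$ on the edges put $If(x)=\sum_{\alpha\in P(x)}f(\alpha)\in[0,\infty]$. For an arbitrary set $E\subseteq\partial T$ let $\Omega_E=\{f\in\ell^p:\ f\ge0,\ If\ge1\text{ on }E\}$ and $c_p(E)=\inf_{f\in\Omega_E}\|f\|_p^p$; the $p$-equilibrium function of $E$ is the $f\in\overline{\Omega_E}^{\ell^p}$ with $\|f\|_p^p=c_p(E)$.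 For a finite positive Borel measure $\mu$ on $\partial T$ let $M(\alpha)=\mu(\partial T_\alpha)$ and $M_p=M^{p'-1}$. The measure $\mu$ is the $p$-equilibrium measure of $E$ if it is carried by $\overline E$, $M_p$ is the $p$-equilibrium function of $E$, and $\mu(\partial T)=c_p(E)$. The same notions for the tree $T_\alpha$ are obtained by using only the edges of $T_\alpha$ and the points of $\partial T_\alpha$; its capacity is denoted by $c_{p,\alpha}$. (1) Let $\mu$ be the $p$-equilibrium measure of $E\subseteq\partial T$. Then, for every edge $\alpha$, one has $IM_p(b(\alpha))<1$, and $$\mu_\alpha:=k_\alpha\,\mu|_{\partial T_\alpha}=\frac{\mu|_{\partial T_\alpha}}{\bigl(1-IM_p(b(\alpha))\bigr)^{p/p'}},\qquad k_\alpha:=\bigl(1-IM_p(b(\alpha))\bigr)^{-p/p'},$$ is the $p$-equilibrium measure of $E_\alpha:=E\cap\partial T_\alpha$ in the tree $T_\alpha$. If $\mu(\partial T\setminus E)=0$ (for instance if $E$ is closed), then also $\mu|_{\partial T_\alpha}=\mu|_{E_\alpha}$, so that $\mu_\alpha=k_\alpha\,\mu|_{E_\alpha}$. (2) Let $E\subseteq\partial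 T$ with $c_p(E)>0$, and let $\alpha$ be an edge other than the root edge such that $E\subseteq\partial T_\alpha$. Then $c_{p,\alpha}(E)>c_p(E)$. -/

import Mathlib

open MeasureTheory
open scoped ENNReal

namespace TreeCapacity

noncomputable section

/-! ### Rooted trees, their edges and their boundary -/

/-- `G` is a locally finite tree, rooted at a vertex `o` with exactly one neighbour. -/
structure IsRootedTree {V : Type*} (G : SimpleGraph V) (o : V) : Prop where
  isTree : G.IsTree
  locallyFinite : ∀ v : V, (G.neighborSet v).Finite
  root_neighbor : ∃! x : V, G.Adj o x

/-- The edges of the tree. An edge is recorded together with its orientation away from the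
root: `b` is its beginning vertex, `e` its ending vertex. In a tree every edge carries
exactly one such orientation. -/
@[ext]
structure Edge {V : Type*} (G : SimpleGraph V) (o : V) where
  b : V
  e : V
  adj : G.Adj b e
  outward : G.dist o e = G.dist o b + 1

variable {V : Type*} {G : SimpleGraph V} {o : V}

/-- The predecessor set `P(x)` of a vertex: the edges crossed by the geodesic from `o` to `x`. -/
def vertexPred (G : SimpleGraph V) (o x : V) : Set (Edge G o) :=
  {α | ∃ w : G.Walk o x, w.IsPath ∧ s(α.b, α.e) ∈ w.edges}

/-- `α ≤ β` if the geodesic which starts at the root and ends with `β` passes through `α`. -/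
instance : LE (Edge G o) := ⟨fun α β => α ∈ vertexPred G o β.e⟩

/-- An edge is a leaf if no other edge lies beyond it. -/
def Edge.IsLeaf (α : Edge G o) : Prop := ∀ β : Edge G o, α ≤ β → β = α

/-- The boundary of the tree: half-infinite geodesics starting from the root, and leaves. -/
inductive Boundary {V : Type*} (G : SimpleGraph V) (o : V) where
  | ray (r : ℕ → V) (start : r 0 = o) (adj : ∀ n, G.Adj (r n) (r (n + 1)))
      (inj : Function.Injective r) : Boundary G o
  | leaf (α : Edge G o) (isLeaf : α.IsLeaf) : Boundary G o

/-- The predecessor set `P(ζ)` of a boundary point. -/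
def Boundary.pred : Boundary G o → Set (Edge G o)
  | .ray r _ _ _ => {α | ∃ n, α.b = r n ∧ α.e = r (n + 1)}
  | .leaf α _ => vertexPred G o α.e

/-- The boundary `∂T_α` of the tent rooted in `α`, as a subset of `∂T`. -/
def tentBoundary (α : Edge G o) : Set (Boundary G o) := {ζ | α ∈ ζ.pred}

/-- The topology of `∂T`, generated by the boundaries of tents. -/
instance : TopologicalSpace (Boundary G o) :=
  TopologicalSpace.generateFrom (Set.range (tentBoundary (G := G) (o := o)))

instance : MeasurableSpace (Boundary G o) := borel _

instance : BorelSpace (Boundary G o) := ⟨rfl⟩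

/-- The edges `β ≥ α` of the tent `T_α`. -/
abbrev TentEdge (α : Edge G o) : Type _ := {β : Edge G o // α ≤ β}

/-- The predecessor set, inside the tent `T_α`, of a point of `∂T_α`. -/
def tentPred (α : Edge G o) (ζ : tentBoundary α) : Set (TentEdge α) :=
  {β | β.1 ∈ ζ.1.pred}

/-! ### Potential theory

The ambient tree enters through the set `ι` of its edges, its boundary `X`, and the map `P`
which sends a boundary point to its predecessor set. It is used for the whole tree,
`P = Boundary.pred`, and for a tent, `P = tentPred α`. -/

instance factOneLeOfReal {p : ℝ} [h : Fact (1 < p)] : Fact (1 ≤ ENNReal.ofReal p) :=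
  ⟨by rw [← ENNReal.ofReal_one]; exact ENNReal.ofReal_le_ofReal h.out.le⟩

/-- The space `ℓ^p` of `p`-summable real functions on the edges. -/
abbrev EdgeLp (ι : Type*) (p : ℝ) := lp (fun _ : ι => ℝ) (ENNReal.ofReal p)

/-- The potential `If` of a nonnegative edge function, at a vertex or boundary point with
predecessor set `S`: the sum of `f` over `S`, possibly infinite. -/
def potential {ι : Type*} (S : Set ι) (f : ι → ℝ) : ℝ≥0∞ := ∑' i : S, ENNReal.ofReal (f i)

/-- The set `Ω_E` of the nonnegative `ℓ^p` functions whose potential is at least `1` on `E`. -/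
def testFunctions {ι X : Type*} (P : X → Set ι) (p : ℝ) (E : Set X) : Set (EdgeLp ι p) :=
  {f | (∀ i, 0 ≤ f i) ∧ ∀ x ∈ E, 1 ≤ potential (P x) f}

variable {ι X : Type*}

/-- The `p`-capacity `c_p(E)`. -/
def capacity (P : X → Set ι) (p : ℝ) [Fact (1 < p)] (E : Set X) : ℝ≥0∞ :=
  ⨅ f ∈ testFunctions P p E, ‖f‖ₑ ^ p

/-- `f` is the `p`-equilibrium function of `E`: it is in the `ℓ^p`-closure of `Ω_E` and
`‖f‖_p^p = c_p(E)`. -/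
def IsEquilibriumFunction (P : X → Set ι) (p : ℝ) [Fact (1 < p)] (E : Set X)
    (f : EdgeLp ι p) : Prop :=
  f ∈ closure (testFunctions P p E) ∧ ‖f‖ₑ ^ p = capacity P p E

/-- The co-potential `M` of a measure: `M(α)` is the mass of the boundary of the tent `T_α`. -/
def copotential [MeasurableSpace X] (P : X → Set ι) (μ : Measure X) (i : ι) : ℝ :=
  μ.real {x | i ∈ P x}

/-- The edge function `M_p = M^{p'-1}` associated to a measure. -/
def edgeFunction [MeasurableSpace X] (P : X → Set ι) (p : ℝ) (μ : Measure X) (i : ι) : ℝ :=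
  copotential P μ i ^ (p.conjExponent - 1)

/-- `μ` is the `p`-equilibrium measure of `E`: a finite Borel measure carried by the closure
of `E`, whose edge function `M_p` is the `p`-equilibrium function of `E`, and whose total mass
is `c_p(E)`. -/
structure IsEquilibriumMeasure [TopologicalSpace X] [MeasurableSpace X] (P : X → Set ι)
    (p : ℝ) [Fact (1 < p)] (E : Set X) (μ : Measure X) : Prop where
  finite : IsFiniteMeasure μ
  carried : μ (closure E)ᶜ = 0
  equilibrium : ∃ f : EdgeLp ι p, IsEquilibriumFunction P p E f ∧
    ∀ i, f i = edgeFunction P p μ i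
  mass : μ Set.univ = capacity P p E

/-! ### The rescaled measure on a tent -/

/-- `IM_p(b(α))`, the potential of `M_p` at the beginning vertex of `α`. -/
def potentialAtBeginning (p : ℝ) (μ : Measure (Boundary G o)) (α : Edge G o) : ℝ≥0∞ :=
  potential (vertexPred G o α.b) (edgeFunction Boundary.pred p μ)

/-- The constant `k_α = (1 - IM_p(b(α)))^{-p/p'}`. -/
def rescalingConstant (p : ℝ) (μ : Measure (Boundary G o)) (α : Edge G o) : ℝ≥0∞ :=
  ((1 - potentialAtBeginning p μ α) ^ (p / p.conjExponent))⁻¹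

/-- The measure `μ|_{∂T_α} / (1 - IM_p(b(α)))^{p/p'}`, as a measure on `∂T_α`. -/
def rescaledMeasure (p : ℝ) (μ : Measure (Boundary G o)) (α : Edge G o) :
    Measure (tentBoundary α) :=
  rescalingConstant p μ α • μ.comap ((↑) : tentBoundary α → Boundary G o)

end

end TreeCapacity

/-!
Everything rests on one surgery: inside the tent `T_α` replace a function `f` by the multiple
`(1 - If(b(α))) h` of a test function `h` of the tent. If `f` is a test function of `E`, so is the
result.

Let `f` be the equilibrium function of `E`. Since the surgery cannot decrease its norm,
`f / (1 - If(b(α)))` has minimal norm among the test functions of the tent. Taking for `h` the unit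
mass on the first edge of the tent gives `f(α) ≤ 1 - If(b(α))`, hence `If ≤ 1` everywhere.
If `f = M_p`, then `1 - If` cannot reach zero at a vertex: `f`, and with it `μ`, would vanish beyond
this vertex, but not on the edge leading to it. Finally the energy `‖f‖_p^p = ∫ If dμ` is the
capacity of `E`, which is the mass of `μ`, so `If = 1` almost everywhere; the same identity in the
tent gives the mass of the rescaled measure.

For the strict inequality apply the surgery to the function with a single value `a` on the edge
which ends at `b(α)`: this yields `c_p(E) ≤ (1 - a)^p c_{p,α}(E) + a^p`, where for small `a` the
gain `p a c_{p,α}(E)` outweighs the cost `a^p`, because `p > 1`.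
-/

namespace TreeCapacity

/-! ### Predecessor sets in a tree -/

section Tree

variable {V : Type*} {G : SimpleGraph V} {o : V}

theorem countable_of_connected (hG : G.Connected) (hN : ∀ v, (G.neighborSet v).Countable) :
    Countable V := by
  have hwalk (n : ℕ) (v : V) : {w | ∃ q : G.Walk v w, q.length = n}.Countable := by
    induction n generalizing v with
    | zero =>
      refine (Set.countable_singleton v).mono ?_
      rintro w ⟨q, hq⟩
      exact (q.eq_of_length_eq_zero hq).symm
    | succ n ih =>
      refine ((hN v).biUnion fun u _ => ih u).mono ?_
      rintro w ⟨q, hq⟩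
      cases q with
      | nil => simp at hq
      | cons hadj q => exact Set.mem_biUnion hadj ⟨q, by simpa using hq⟩
  obtain ⟨v⟩ := hG.nonempty
  refine Set.countable_univ_iff.1 ((Set.countable_iUnion fun n => hwalk n v).mono fun w _ => ?_)
  obtain ⟨q⟩ := hG v w
  exact Set.mem_iUnion.2 ⟨q.length, q, rfl⟩

theorem IsRootedTree.countable (hT : IsRootedTree G o) : Countable V :=
  countable_of_connected hT.isTree.connected fun v => (hT.locallyFinite v).countable

instance [Countable V] : Countable (Edge G o) :=
  Function.Injective.countable (f := fun α : Edge G o => (α.b, α.e)) fun _ _ h =>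
    Edge.ext (congrArg Prod.fst h) (congrArg Prod.snd h)

theorem Edge.mk_eq_mk_iff {α β : Edge G o} : s(α.b, α.e) = s(β.b, β.e) ↔ α = β := by
  refine ⟨fun h => ?_, fun h => h ▸ rfl⟩
  rcases Sym2.eq_iff.1 h with ⟨hb, he⟩ | ⟨hb, he⟩
  · exact Edge.ext hb he
  · have hα := α.outward
    have hβ := β.outward
    rw [hb, he] at hα
    omega

theorem exists_edge_e_eq (hG : G.IsTree) {x : V} (hx : x ≠ o) : ∃ β : Edge G o, β.e = x := by
  obtain ⟨w, hw⟩ := hG.connected.exists_walk_length_eq_dist x o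
  cases w with
  | nil => exact absurd rfl hx
  | @cons _ y _ hadj q =>
    refine ⟨⟨y, x, hadj.symm, ?_⟩, rfl⟩
    have hle := SimpleGraph.dist_le q
    have hdist := hG.dist_eq_dist_add_one_of_adj o hadj
    rw [SimpleGraph.Walk.length_cons, SimpleGraph.dist_comm] at hw
    rw [SimpleGraph.dist_comm] at hle
    omega

theorem vertex_induction (hG : G.IsTree) {motive : V → Prop} (root : motive o)
    (step : ∀ β : Edge G o, motive β.b → motive β.e) (x : V) : motive x := by
  induction hn : G.dist o x using Nat.strong_induction_on generalizing x with
  | _ n ih =>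
    by_cases hx : x = o
    · exact hx ▸ root
    · obtain ⟨β, rfl⟩ := exists_edge_e_eq hG hx
      exact step β (ih _ (by rw [← hn, β.outward]; omega) _ rfl)

theorem mem_vertexPred_iff_of_isPath (hG : G.IsTree) {x : V} {w : G.Walk o x} (hw : w.IsPath)
    {α : Edge G o} : α ∈ vertexPred G o x ↔ s(α.b, α.e) ∈ w.edges := by
  refine ⟨?_, fun h => ⟨w, hw, h⟩⟩
  rintro ⟨w', hw', h⟩
  rwa [(hG.existsUnique_path o x).unique hw hw']

theorem vertexPred_root (hG : G.IsTree) : vertexPred G o o = ∅ := by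
  ext α
  simp [mem_vertexPred_iff_of_isPath hG SimpleGraph.Walk.IsPath.nil]

theorem vertexPred_e (hG : G.IsTree) (β : Edge G o) :
    vertexPred G o β.e = insert β (vertexPred G o β.b) := by
  obtain ⟨w, hw, hlen⟩ := hG.connected.exists_path_of_dist o β.b
  have hconcat : (w.concat β.adj).IsPath :=
    SimpleGraph.Walk.isPath_of_length_eq_dist _ (by simp [hlen, β.outward])
  ext α
  simp only [mem_vertexPred_iff_of_isPath hG hw, mem_vertexPred_iff_of_isPath hG hconcat,
    SimpleGraph.Walk.edges_concat, List.concat_eq_append, List.mem_append, List.mem_singleton,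
    Edge.mk_eq_mk_iff, Set.mem_insert_iff, or_comm]

theorem Edge.le_iff_eq_or_mem_vertexPred_b (hG : G.IsTree) {α β : Edge G o} :
    α ≤ β ↔ α = β ∨ α ∈ vertexPred G o β.b :=
  Set.ext_iff.1 (vertexPred_e hG β) α

theorem Edge.le_refl (hG : G.IsTree) (α : Edge G o) : α ≤ α :=
  (Edge.le_iff_eq_or_mem_vertexPred_b hG).2 (Or.inl rfl)

theorem finite_vertexPred (hG : G.IsTree) (x : V) : (vertexPred G o x).Finite := by
  induction x using vertex_induction (o := o) hG with
  | root => simp [vertexPred_root hG]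
  | step β ih => rw [vertexPred_e hG]; exact ih.insert β

theorem dist_e_le_of_mem_vertexPred (hG : G.IsTree) {α : Edge G o} {x : V} :
    α ∈ vertexPred G o x → G.dist o α.e ≤ G.dist o x := by
  induction x using vertex_induction (o := o) hG with
  | root => simp [vertexPred_root hG]
  | step β ih =>
    rw [vertexPred_e hG, β.outward]
    rintro (rfl | h)
    · exact α.outward.le
    · exact (ih h).trans (Nat.le_succ _)

theorem Edge.notMem_vertexPred_b_of_le (hG : G.IsTree) {α β : Edge G o} (h : α ≤ β) :
    β ∉ vertexPred G o α.b := fun hβ => by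
  have hβα := dist_e_le_of_mem_vertexPred hG hβ
  have hαβ := dist_e_le_of_mem_vertexPred hG (show α ∈ vertexPred G o β.e from h)
  have hα := α.outward
  omega

theorem Edge.e_injective (hG : G.IsTree) : Function.Injective (Edge.e : Edge G o → V) := by
  intro β γ h
  have hγβ : γ ≤ β := show γ ∈ vertexPred G o β.e from h ▸ Edge.le_refl hG γ
  refine ((Edge.le_iff_eq_or_mem_vertexPred_b hG).1 hγβ).elim Eq.symm fun hγ => ?_
  have hdist := dist_e_le_of_mem_vertexPred hG hγ
  rw [← h, β.outward] at hdist
  omega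

theorem vertexPred_subset_of_mem (hG : G.IsTree) {α : Edge G o} {x : V} :
    α ∈ vertexPred G o x → vertexPred G o α.e ⊆ vertexPred G o x := by
  induction x using vertex_induction (o := o) hG with
  | root => simp [vertexPred_root hG]
  | step β ih =>
    rw [vertexPred_e hG β]
    rintro (rfl | h)
    · rw [vertexPred_e hG]
    · exact (ih h).trans (Set.subset_insert _ _)

theorem le_total_of_mem_vertexPred (hG : G.IsTree) {α β : Edge G o} {x : V} :
    α ∈ vertexPred G o x → β ∈ vertexPred G o x → α ≤ β ∨ β ≤ α := by
  induction x using vertex_induction (o := o) hG with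
  | root => simp [vertexPred_root hG]
  | step γ ih =>
    intro hα hβ
    rcases (Edge.le_iff_eq_or_mem_vertexPred_b hG).1 hα with rfl | hα'
    · exact Or.inr hβ
    rcases (Edge.le_iff_eq_or_mem_vertexPred_b hG).1 hβ with rfl | hβ'
    · exact Or.inl hα
    exact ih hα' hβ'

theorem e_eq_or_exists_b_eq_of_mem_vertexPred (hG : G.IsTree) {β : Edge G o} {x : V} :
    β ∈ vertexPred G o x → β.e = x ∨ ∃ γ ∈ vertexPred G o x, γ.b = β.e := by
  induction x using vertex_induction (o := o) hG with
  | root => simp [vertexPred_root hG]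
  | step δ ih =>
    rw [vertexPred_e hG]
    rintro (rfl | h)
    · exact Or.inl rfl
    · rcases ih h with he | ⟨γ, hγ, hb⟩
      · exact Or.inr ⟨δ, Set.mem_insert _ _, he.symm⟩
      · exact Or.inr ⟨γ, Set.mem_insert_of_mem _ hγ, hb⟩

section Ray

variable {r : ℕ → V}

theorem dist_ray_succ (hG : G.IsTree) (start : r 0 = o) (adj : ∀ n, G.Adj (r n) (r (n + 1)))
    (inj : Function.Injective r) (n : ℕ) : G.dist o (r (n + 1)) = G.dist o (r n) + 1 := by
  induction n with
  | zero =>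
    have hdist := hG.dist_eq_dist_add_one_of_adj o (adj 0)
    rw [start, SimpleGraph.dist_self] at *
    omega
  | succ n ih =>
    rcases hG.dist_eq_dist_add_one_of_adj o (adj (n + 1)) with h | h
    · have hedge := Edge.e_injective hG (a₁ := ⟨_, _, adj n, ih⟩)
        (a₂ := ⟨_, _, (adj (n + 1)).symm, h⟩) rfl
      have hn : n = n + 1 + 1 := inj (congrArg Edge.b hedge)
      omega
    · exact h

theorem vertexPred_ray (hG : G.IsTree) (start : r 0 = o) (adj : ∀ n, G.Adj (r n) (r (n + 1)))
    (inj : Function.Injective r) (n : ℕ) :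
    vertexPred G o (r n) = {α | ∃ k < n, α.b = r k ∧ α.e = r (k + 1)} := by
  induction n with
  | zero => simp [start, vertexPred_root hG]
  | succ n ih =>
    have hpred := vertexPred_e hG ⟨_, _, adj n, dist_ray_succ hG start adj inj n⟩
    simp only [ih] at hpred
    ext α
    simp only [hpred, Set.mem_insert_iff, Set.mem_ofPred_eq, Edge.ext_iff,
      Nat.exists_lt_succ_right, or_comm]

end Ray

theorem exists_vertexPred_between (hG : G.IsTree) {ζ : Boundary G o} {F : Finset (Edge G o)}
    (hF : ↑F ⊆ ζ.pred) : ∃ x, ↑F ⊆ vertexPred G o x ∧ vertexPred G o x ⊆ ζ.pred := by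
  cases ζ with
  | leaf δ _ => exact ⟨δ.e, hF, subset_rfl⟩
  | ray r start adj inj =>
    choose! n hn using fun α (hα : α ∈ F) => show ∃ n, α.b = r n ∧ α.e = r (n + 1) from hF hα
    refine ⟨r (F.sup n + 1), fun α hα => ?_, ?_⟩ <;> rw [vertexPred_ray hG start adj inj]
    · exact ⟨n α, Nat.lt_succ_of_le (Finset.le_sup hα), hn α hα⟩
    · rintro γ ⟨k, -, hk⟩
      exact ⟨k, hk⟩

theorem vertexPred_subset_pred (hG : G.IsTree) {ζ : Boundary G o} {α : Edge G o}
    (hα : α ∈ ζ.pred) : vertexPred G o α.e ⊆ ζ.pred := by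
  obtain ⟨x, hx, hxζ⟩ := exists_vertexPred_between hG (F := {α}) (by simpa using hα)
  exact (vertexPred_subset_of_mem hG (hx (by simp))).trans hxζ

theorem le_total_of_mem_pred (hG : G.IsTree) {ζ : Boundary G o} {α β : Edge G o}
    (hα : α ∈ ζ.pred) (hβ : β ∈ ζ.pred) : α ≤ β ∨ β ≤ α := by
  classical
  obtain ⟨x, hx, -⟩ := exists_vertexPred_between hG (ζ := ζ) (F := {α, β})
    (by simp [Set.insert_subset_iff, hα, hβ])
  exact le_total_of_mem_vertexPred hG (hx (by simp)) (hx (by simp))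

theorem pred_eq_vertexPred_union_tentPred (hG : G.IsTree) {α : Edge G o} (ζ : tentBoundary α) :
    ζ.1.pred = vertexPred G o α.b ∪ Subtype.val '' tentPred α ζ := by
  ext β
  constructor
  · intro hβ
    rcases le_total_of_mem_pred hG ζ.2 hβ with hαβ | hβα
    · exact Or.inr ⟨⟨β, hαβ⟩, hβ, rfl⟩
    rcases (Edge.le_iff_eq_or_mem_vertexPred_b hG).1 hβα with rfl | hβ'
    · exact Or.inr ⟨⟨β, hβα⟩, hβ, rfl⟩
    · exact Or.inl hβ'
  · rintro (hβ | ⟨γ, hγ, rfl⟩)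
    · exact vertexPred_subset_pred hG ζ.2 ((Edge.le_iff_eq_or_mem_vertexPred_b hG).2 (Or.inr hβ))
    · exact hγ

theorem tentBoundary_subset (hG : G.IsTree) {α β : Edge G o} (h : α ≤ β) :
    tentBoundary β ⊆ tentBoundary α :=
  fun _ hζ => vertexPred_subset_pred hG hζ h

theorem Edge.IsLeaf.b_ne_e (hG : G.IsTree) {δ : Edge G o} (hδ : δ.IsLeaf) (α : Edge G o) :
    α.b ≠ δ.e := fun h => by
  have hα : α = δ := hδ α ((Edge.le_iff_eq_or_mem_vertexPred_b hG).2 (Or.inr (h ▸ le_refl hG δ)))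
  exact α.adj.ne (h.trans (congrArg Edge.e hα.symm))

theorem tentBoundary_subset_iUnion_of_b_eq_e (hG : G.IsTree) {α β : Edge G o} (h : α.b = β.e) :
    tentBoundary β ⊆ ⋃ γ : {γ : Edge G o // γ.b = β.e}, tentBoundary γ.1 := by
  suffices ∀ ζ ∈ tentBoundary β, ∃ γ ∈ ζ.pred, γ.b = β.e from fun ζ hζ =>
    have ⟨γ, hγ, hb⟩ := this ζ hζ
    Set.mem_iUnion.2 ⟨⟨γ, hb⟩, hγ⟩
  rintro (⟨r, start, adj, inj⟩ | ⟨δ, hδ⟩) hζ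
  · obtain ⟨n, -, hn⟩ := hζ
    exact ⟨⟨_, _, adj (n + 1), dist_ray_succ hG start adj inj (n + 1)⟩, ⟨n + 1, rfl, rfl⟩, hn.symm⟩
  · exact (e_eq_or_exists_b_eq_of_mem_vertexPred hG hζ).resolve_left fun he =>
      hδ.b_ne_e hG α (h.trans he)

theorem isOpen_tentBoundary (α : Edge G o) : IsOpen (tentBoundary α) :=
  TopologicalSpace.isOpen_generateFrom_of_mem ⟨α, rfl⟩

theorem measurableSet_tentBoundary (α : Edge G o) : MeasurableSet (tentBoundary α) :=
  (isOpen_tentBoundary α).measurableSet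

end Tree

/-! ### Restriction and extension in `ℓ^p` -/

namespace EdgeLp

variable {ι κ : Type*} {p : ℝ} [hp : Fact (1 < p)]

theorem toReal_exponent : (ENNReal.ofReal p).toReal = p :=
  ENNReal.toReal_ofReal (zero_lt_one.trans hp.out).le

theorem exponent_pos : 0 < ENNReal.ofReal p := ENNReal.ofReal_pos.2 (zero_lt_one.trans hp.out)

theorem toReal_exponent_pos : 0 < (ENNReal.ofReal p).toReal :=
  ENNReal.toReal_pos exponent_pos.ne' ENNReal.ofReal_ne_top

theorem memℓp_iff_summable {f : ι → ℝ} :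
    Memℓp f (ENNReal.ofReal p) ↔ Summable fun i => ‖f i‖ ^ p := by
  rw [memℓp_gen_iff toReal_exponent_pos, toReal_exponent]

theorem norm_rpow_eq_tsum (f : EdgeLp ι p) : ‖f‖ ^ p = ∑' i, ‖f i‖ ^ p := by
  have h := lp.norm_rpow_eq_tsum toReal_exponent_pos f
  rwa [toReal_exponent] at h

theorem continuous_apply (i : ι) : Continuous fun f : EdgeLp ι p => f i :=
  (lp.evalCLM ℝ (fun _ : ι => ℝ) (ENNReal.ofReal p) i).continuous

theorem enorm_rpow_eq_ofReal {E : Type*} [SeminormedAddGroup E] (x : E) :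
    ‖x‖ₑ ^ p = ENNReal.ofReal (‖x‖ ^ p) := by
  rw [← ofReal_norm,
    ENNReal.ofReal_rpow_of_nonneg (norm_nonneg _) (zero_lt_one.trans hp.out).le]

theorem enorm_rpow_eq_tsum (f : EdgeLp ι p) : ‖f‖ₑ ^ p = ∑' i, ‖f i‖ₑ ^ p := by
  simp_rw [enorm_rpow_eq_ofReal, norm_rpow_eq_tsum]
  exact ENNReal.ofReal_tsum_of_nonneg (fun i => by positivity) (memℓp_iff_summable.1 (lp.memℓp f))

theorem norm_le_of_rpow_le {E F : Type*} [SeminormedAddGroup E] [SeminormedAddGroup F]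
    {x : E} {y : F} (h : ‖x‖ₑ ^ p ≤ ‖y‖ₑ ^ p) : ‖x‖ ≤ ‖y‖ :=
  enorm_le_iff_norm_le.1 ((ENNReal.rpow_le_rpow_iff (zero_lt_one.trans hp.out)).1 h)

variable (g : κ ↪ ι)

/-- The restriction of an `ℓ^p` function along an embedding of the index sets. -/
noncomputable def comap : EdgeLp ι p →L[ℝ] EdgeLp κ p :=
  LinearMap.mkContinuous
    { toFun f := ⟨fun k => f (g k), memℓp_iff_summable.2
        ((memℓp_iff_summable.1 (lp.memℓp f)).comp_injective g.injective)⟩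
      map_add' _ _ := rfl
      map_smul' _ _ := rfl } 1 fun f => by
    rw [one_mul]
    refine norm_le_of_rpow_le (p := p) ?_
    simp_rw [enorm_rpow_eq_tsum]
    exact ENNReal.tsum_comp_le_tsum_of_injective g.injective fun i => ‖f i‖ₑ ^ p

@[simp]
theorem comap_apply (f : EdgeLp ι p) (k : κ) : comap g f k = f (g k) := rfl

theorem enorm_extend_rpow (h : κ → ℝ) :
    (fun i => ‖Function.extend g h 0 i‖ₑ ^ p) = Function.extend g (fun k => ‖h k‖ₑ ^ p) 0 := by
  ext i
  by_cases hi : ∃ k, g k = i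
  · obtain ⟨k, rfl⟩ := hi
    simp [g.injective.extend_apply]
  · simp [Function.extend_apply' _ _ _ hi, ENNReal.zero_rpow_of_pos (zero_lt_one.trans hp.out)]

theorem memℓp_extend (h : EdgeLp κ p) : Memℓp (Function.extend g h 0) (ENNReal.ofReal p) := by
  rw [memℓp_iff_summable, ← Function.Injective.summable_iff g.injective fun i hi => by
    simp [Function.extend_apply' _ _ _ hi, Real.zero_rpow (zero_lt_one.trans hp.out).ne']]
  exact (memℓp_iff_summable.1 (lp.memℓp h)).congr fun k => by simp [g.injective.extend_apply]

/-- The extension by zero of an `ℓ^p` function along an embedding of the index sets. -/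
noncomputable def extend : EdgeLp κ p →L[ℝ] EdgeLp ι p :=
  LinearMap.mkContinuous
    { toFun h := ⟨Function.ExtendByZero.linearMap ℝ g h, memℓp_extend g h⟩
      map_add' h₁ h₂ := Subtype.ext (map_add (Function.ExtendByZero.linearMap ℝ g) ⇑h₁ ⇑h₂)
      map_smul' c h := Subtype.ext (map_smul (Function.ExtendByZero.linearMap ℝ g) c ⇑h) } 1
    fun h => by
      rw [one_mul]
      refine norm_le_of_rpow_le (p := p) ?_
      rw [enorm_rpow_eq_tsum, enorm_rpow_eq_tsum]
      exact ((congrArg tsum (enorm_extend_rpow g h)).trans (tsum_extend_zero g.injective _)).le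

theorem extend_apply (h : EdgeLp κ p) (k : κ) : extend g h (g k) = h k :=
  g.injective.extend_apply _ _ _

theorem extend_apply_of_notMem_range (h : EdgeLp κ p) {i : ι} (hi : i ∉ Set.range g) :
    extend g h i = 0 :=
  Function.extend_apply' _ _ _ hi

/-- The function which is given by `h` on the range of the embedding `g` and by `f` elsewhere. -/
noncomputable def glue (f : EdgeLp ι p) (h : EdgeLp κ p) : EdgeLp ι p :=
  f + extend g (h - comap g f)

theorem glue_apply (f : EdgeLp ι p) (h : EdgeLp κ p) (k : κ) : glue g f h (g k) = h k := by
  simp [glue, extend_apply]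

theorem glue_apply_of_notMem_range (f : EdgeLp ι p) (h : EdgeLp κ p) {i : ι}
    (hi : i ∉ Set.range g) : glue g f h i = f i := by
  simp [glue, extend_apply_of_notMem_range g _ hi]

theorem glue_comap (f : EdgeLp ι p) : glue g f (comap g f) = f := by simp [glue]

theorem continuous_glue : Continuous fun x : EdgeLp ι p × EdgeLp κ p => glue g x.1 x.2 := by
  unfold glue
  fun_prop

theorem enorm_glue_rpow (f : EdgeLp ι p) (h : EdgeLp κ p) :
    ‖glue g f h‖ₑ ^ p = ‖h‖ₑ ^ p + ∑' i : ↥(Set.range g)ᶜ, ‖f i‖ₑ ^ p := by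
  rw [enorm_rpow_eq_tsum, enorm_rpow_eq_tsum,
    ← ENNReal.summable.tsum_add_tsum_compl (s := Set.range g) ENNReal.summable,
    tsum_range (fun i => ‖glue g f h i‖ₑ ^ p) g.injective]
  simp_rw [glue_apply]
  congr 1
  exact tsum_congr fun i => by rw [glue_apply_of_notMem_range g f h i.2]

theorem enorm_glue_rpow_le (f : EdgeLp ι p) (h : EdgeLp κ p) :
    ‖glue g f h‖ₑ ^ p ≤ ‖h‖ₑ ^ p + ‖f‖ₑ ^ p := by
  rw [enorm_glue_rpow, enorm_rpow_eq_tsum f]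
  gcongr
  exact ENNReal.tsum_comp_le_tsum_of_injective Subtype.val_injective fun i => ‖f i‖ₑ ^ p

theorem norm_comap_le_of_norm_le_norm_glue {f : EdgeLp ι p} {h : EdgeLp κ p}
    (hle : ‖f‖ₑ ^ p ≤ ‖glue g f h‖ₑ ^ p) : ‖comap g f‖ ≤ ‖h‖ := by
  have hsplit := enorm_glue_rpow g f (comap g f)
  rw [glue_comap] at hsplit
  have hfin : ‖f‖ₑ ^ p ≠ ∞ :=
    ENNReal.rpow_ne_top_of_nonneg (zero_lt_one.trans hp.out).le enorm_ne_top
  rw [hsplit, enorm_glue_rpow] at hle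
  exact norm_le_of_rpow_le ((ENNReal.add_le_add_iff_right
    (ne_top_of_le_ne_top hfin (le_add_self.trans_eq hsplit.symm))).1 hle)

end EdgeLp

/-! ### Potentials, capacities and energies -/

section Potential

variable {ι κ X : Type*} {S T : Set ι} {f g : ι → ℝ}

theorem potential_congr (h : ∀ i ∈ S, f i = g i) : potential S f = potential S g :=
  tsum_congr fun i => by rw [h i i.2]

theorem potential_mono (h : S ⊆ T) : potential S f ≤ potential T f :=
  ENNReal.tsum_mono_subtype (fun i => ENNReal.ofReal (f i)) h

theorem potential_const_mul {c : ℝ} (hc : 0 ≤ c) (S : Set ι) (f : ι → ℝ) :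
    potential S (fun i => c * f i) = ENNReal.ofReal c * potential S f := by
  simp_rw [potential, ENNReal.ofReal_mul hc, ENNReal.tsum_mul_left]

theorem ofReal_le_potential {i : ι} (hi : i ∈ S) : ENNReal.ofReal (f i) ≤ potential S f :=
  ENNReal.le_tsum (f := fun i : S => ENNReal.ofReal (f i)) ⟨i, hi⟩

theorem potential_union (h : Disjoint S T) (f : ι → ℝ) :
    potential (S ∪ T) f = potential S f + potential T f :=
  ENNReal.summable.tsum_union_disjoint (f := fun i => ENNReal.ofReal (f i)) h ENNReal.summable

theorem potential_image (g : κ ↪ ι) (S : Set κ) (f : ι → ℝ) :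
    potential (g '' S) f = potential S (f ∘ g) :=
  tsum_image (fun i => ENNReal.ofReal (f i)) g.injective.injOn

theorem potential_coe_finset (F : Finset ι) (f : ι → ℝ) :
    potential (F : Set ι) f = ∑ i ∈ F, ENNReal.ofReal (f i) :=
  Finset.tsum_subtype F fun i => ENNReal.ofReal (f i)

theorem potential_eq_ofReal_finsum (hS : S.Finite) (hf : ∀ i, 0 ≤ f i) :
    potential S f = ENNReal.ofReal (∑ᶠ i ∈ S, f i) := by
  lift S to Finset ι using hS
  rw [finsum_mem_coe_finset, ENNReal.ofReal_sum_of_nonneg fun i _ => hf i, potential_coe_finset]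

theorem potential_le_of_forall_finset {c : ℝ≥0∞}
    (h : ∀ F : Finset ι, ↑F ⊆ S → potential (F : Set ι) f ≤ c) : potential S f ≤ c := by
  refine ENNReal.summable.tsum_le_of_sum_le fun F => ?_
  have hF := h (F.map (Function.Embedding.subtype _)) (by simp)
  rwa [potential_coe_finset, Finset.sum_map] at hF

variable {P : X → Set ι} {p : ℝ} {E : Set X}

theorem single_mem_testFunctions [DecidableEq ι] {i : ι} (hE : ∀ x ∈ E, i ∈ P x) :
    lp.single (ENNReal.ofReal p) i (1 : ℝ) ∈ testFunctions P p E := by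
  refine ⟨?_, fun x hx => (ofReal_le_potential (hE x hx)).trans' (by simp)⟩
  exact (Pi.single_nonneg (α := fun _ => ℝ) (i := i)).2 zero_le_one

section EdgeFunction

variable [MeasurableSpace X] {μ : Measure X}

theorem edgeFunction_nonneg (i : ι) : 0 ≤ edgeFunction P p μ i :=
  Real.rpow_nonneg measureReal_nonneg _

theorem edgeFunction_smul (c : ℝ≥0∞) (i : ι) :
    edgeFunction P p (c • μ) i = c.toReal ^ (p.conjExponent - 1) * edgeFunction P p μ i := by
  simp_rw [edgeFunction, copotential, measureReal_ennreal_smul_apply]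
  exact Real.mul_rpow ENNReal.toReal_nonneg measureReal_nonneg

end EdgeFunction

variable [hp : Fact (1 < p)]

theorem nonneg_of_mem_closure {f : EdgeLp ι p} (hf : f ∈ closure (testFunctions P p E)) (i : ι) :
    0 ≤ f i :=
  closure_minimal (fun _ hg => hg.1 i) (isClosed_le continuous_const (EdgeLp.continuous_apply i)) hf

theorem capacity_le_of_mem_closure {f : EdgeLp ι p} (hf : f ∈ closure (testFunctions P p E)) :
    capacity P p E ≤ ‖f‖ₑ ^ p :=
  closure_minimal (fun g hg => iInf₂_le (f := fun g (_ : g ∈ testFunctions P p E) => ‖g‖ₑ ^ p) g hg)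
    (isClosed_le continuous_const (ENNReal.continuous_rpow_const.comp continuous_enorm)) hf

theorem capacity_le_one {i : ι} (hE : ∀ x ∈ E, i ∈ P x) : capacity P p E ≤ 1 := by
  classical
  refine (capacity_le_of_mem_closure (subset_closure (single_mem_testFunctions hE))).trans_eq ?_
  rw [EdgeLp.enorm_rpow_eq_ofReal, lp.norm_single EdgeLp.exponent_pos]
  simp

theorem holderConjugate_conjExponent : p.HolderConjugate p.conjExponent :=
  .conjExponent hp.out

variable [MeasurableSpace X] {μ : Measure X}

theorem edgeFunction_eq_zero_iff [IsFiniteMeasure μ] {i : ι} :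
    edgeFunction P p μ i = 0 ↔ μ {x | i ∈ P x} = 0 := by
  rw [edgeFunction, copotential, Real.rpow_eq_zero measureReal_nonneg
    (sub_pos.2 holderConjugate_conjExponent.symm.lt).ne']
  exact measureReal_eq_zero_iff

theorem enorm_edgeFunction_rpow [IsFiniteMeasure μ] (i : ι) :
    ‖edgeFunction P p μ i‖ₑ ^ p = ENNReal.ofReal (edgeFunction P p μ i) * μ {x | i ∈ P x} := by
  have hpq := holderConjugate_conjExponent (p := p)
  have hM : 0 ≤ copotential P μ i := measureReal_nonneg
  rw [EdgeLp.enorm_rpow_eq_ofReal, ← ofReal_measureReal,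
    ← ENNReal.ofReal_mul (edgeFunction_nonneg i), Real.norm_of_nonneg (edgeFunction_nonneg i)]
  congr 1
  calc edgeFunction P p μ i ^ p
      = copotential P μ i ^ (p.conjExponent - 1 + 1) := by
        rw [edgeFunction, ← Real.rpow_mul hM, hpq.symm.sub_one_mul_conj, sub_add_cancel]
    _ = edgeFunction P p μ i * copotential P μ i :=
        Real.rpow_add_one' hM (by simpa using hpq.symm.ne_zero)

theorem enorm_rpow_eq_lintegral_potential [Countable ι] [IsFiniteMeasure μ]
    (hP : ∀ i, MeasurableSet {x | i ∈ P x}) {f : EdgeLp ι p} (hf : ⇑f = edgeFunction P p μ) :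
    ‖f‖ₑ ^ p = ∫⁻ x, potential (P x) f ∂μ := by
  have hpotential (x : X) : potential (P x) f =
      ∑' i, {x | i ∈ P x}.indicator (fun _ => ENNReal.ofReal (f i)) x :=
    tsum_subtype (P x) fun i => ENNReal.ofReal (f i)
  simp_rw [hpotential]
  rw [lintegral_tsum fun i => (measurable_const.indicator (hP i)).aemeasurable,
    EdgeLp.enorm_rpow_eq_tsum]
  refine tsum_congr fun i => ?_
  rw [lintegral_indicator_const (hP i), hf, enorm_edgeFunction_rpow]

theorem measure_univ_eq_enorm_rpow [Countable ι] [IsFiniteMeasure μ]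
    (hP : ∀ i, MeasurableSet {x | i ∈ P x}) {f : EdgeLp ι p} (hf : ⇑f = edgeFunction P p μ)
    (hone : ∀ᵐ x ∂μ, potential (P x) f = 1) : μ Set.univ = ‖f‖ₑ ^ p := by
  rw [enorm_rpow_eq_lintegral_potential hP hf, lintegral_congr_ae hone, lintegral_one]

end Potential

/-! ### Gluing along a tent -/

section Gluing

variable {V : Type*} {G : SimpleGraph V} {o : V}

/-- The deficit `1 - If(x)` of the potential at a vertex, as a real number which is negative where
`If(x) > 1`. -/
noncomputable def deficit (f : Edge G o → ℝ) (x : V) : ℝ := 1 - ∑ᶠ i ∈ vertexPred G o x, f i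

/-- The inclusion of the edges of the tent `T_α` into the edges of the tree. -/
def tentInclusion (α : Edge G o) : TentEdge α ↪ Edge G o := Function.Embedding.subtype (α ≤ ·)

theorem mem_range_tentInclusion {α β : Edge G o} : β ∈ Set.range (tentInclusion α) ↔ α ≤ β :=
  Set.ext_iff.1 Subtype.range_val β

section Deficit

variable {f : Edge G o → ℝ}

theorem deficit_root (hG : G.IsTree) (f : Edge G o → ℝ) : deficit f o = 1 := by
  simp [deficit, vertexPred_root hG]

theorem deficit_e (hG : G.IsTree) (f : Edge G o → ℝ) (β : Edge G o) :
    deficit f β.e = deficit f β.b - f β := by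
  rw [deficit, deficit, vertexPred_e hG, finsum_mem_insert _
    (Edge.notMem_vertexPred_b_of_le hG (Edge.le_refl hG β)) (finite_vertexPred hG _)]
  ring

theorem deficit_le_one (hf : ∀ i, 0 ≤ f i) (x : V) : deficit f x ≤ 1 :=
  sub_le_self _ (finsum_nonneg fun i => finsum_nonneg fun _ => hf i)

theorem potential_vertexPred (hG : G.IsTree) (hf : ∀ i, 0 ≤ f i) (x : V) :
    potential (vertexPred G o x) f = ENNReal.ofReal (1 - deficit f x) := by
  rw [potential_eq_ofReal_finsum (finite_vertexPred hG x) hf, deficit, sub_sub_cancel]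

theorem one_sub_potential_vertexPred (hG : G.IsTree) (hf : ∀ i, 0 ≤ f i) (x : V) :
    1 - potential (vertexPred G o x) f = ENNReal.ofReal (deficit f x) := by
  rw [potential_vertexPred hG hf, ← ENNReal.ofReal_one,
    ← ENNReal.ofReal_sub _ (sub_nonneg.2 (deficit_le_one hf x)), sub_sub_cancel]

theorem potential_pred_eq (hG : G.IsTree) {α : Edge G o} (ζ : tentBoundary α) (f : Edge G o → ℝ) :
    potential ζ.1.pred f =
      potential (vertexPred G o α.b) f + potential (tentPred α ζ) (f ∘ tentInclusion α) := by
  have hdisj : Disjoint (vertexPred G o α.b) (tentInclusion α '' tentPred α ζ) := by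
    rw [Set.disjoint_right]
    rintro _ ⟨γ, -, rfl⟩
    exact Edge.notMem_vertexPred_b_of_le hG γ.2
  rw [pred_eq_vertexPred_union_tentPred hG ζ]
  exact (potential_union hdisj f).trans (congrArg _ (potential_image ..))

theorem one_le_potential_pred_iff (hG : G.IsTree) (hf : ∀ i, 0 ≤ f i) {α : Edge G o}
    (ζ : tentBoundary α) : 1 ≤ potential ζ.1.pred f ↔
      ENNReal.ofReal (deficit f α.b) ≤ potential (tentPred α ζ) (f ∘ tentInclusion α) := by
  rw [potential_pred_eq hG ζ, ← tsub_le_iff_left, one_sub_potential_vertexPred hG hf]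

end Deficit

variable {p : ℝ} [hp : Fact (1 < p)]

theorem continuous_deficit (hG : G.IsTree) (x : V) :
    Continuous fun f : EdgeLp (Edge G o) p => deficit f x := by
  refine continuous_const.sub ?_
  simp_rw [finsum_mem_eq_finite_toFinset_sum _ (finite_vertexPred hG x)]
  exact continuous_finsetSum _ fun i _ => EdgeLp.continuous_apply i

/-- The surgery on which the theorem rests: inside the tent `T_α` the function `f` is replaced by
the multiple of `h` whose factor is the deficit of `f` at the root `b(α)` of the tent. The positive
part keeps the result nonnegative before the deficit is known to be. -/
noncomputable def tentGlue (α : Edge G o) (f : EdgeLp (Edge G o) p) (h : EdgeLp (TentEdge α) p) :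
    EdgeLp (Edge G o) p :=
  EdgeLp.glue (tentInclusion α) f ((deficit f α.b)⁺ • h)

section TentGlue

variable {α : Edge G o} {f : EdgeLp (Edge G o) p} {h : EdgeLp (TentEdge α) p}
  {E : Set (Boundary G o)}

theorem tentGlue_apply (α : Edge G o) (f : EdgeLp (Edge G o) p) (h : EdgeLp (TentEdge α) p)
    (β : TentEdge α) : tentGlue α f h (tentInclusion α β) = (deficit f α.b)⁺ * h β :=
  EdgeLp.glue_apply ..

theorem tentGlue_apply_of_not_le {β : Edge G o} (hβ : ¬ α ≤ β) : tentGlue α f h β = f β :=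
  EdgeLp.glue_apply_of_notMem_range _ _ _ (mem_range_tentInclusion.not.2 hβ)

theorem deficit_tentGlue (hG : G.IsTree) : deficit (tentGlue α f h) α.b = deficit f α.b :=
  congrArg (1 - ·) <| finsum_mem_congr rfl fun _ hi =>
    tentGlue_apply_of_not_le fun hαi => Edge.notMem_vertexPred_b_of_le hG hαi hi

theorem tentGlue_nonneg (hf : ∀ i, 0 ≤ f i) (hh : ∀ i, 0 ≤ h i) (i : Edge G o) :
    0 ≤ tentGlue α f h i := by
  by_cases hi : α ≤ i
  · exact (mul_nonneg (posPart_nonneg _) (hh ⟨i, hi⟩)).trans_eq (tentGlue_apply α f h ⟨i, hi⟩).symm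
  · exact (hf i).trans_eq (tentGlue_apply_of_not_le hi).symm

theorem tentGlue_mem_testFunctions (hG : G.IsTree) (hf : ∀ i, 0 ≤ f i)
    (hfE : ∀ ζ ∈ E \ tentBoundary α, 1 ≤ potential ζ.pred f)
    (hh : h ∈ testFunctions (tentPred α) p ((↑) ⁻¹' E : Set (tentBoundary α))) :
    tentGlue α f h ∈ testFunctions Boundary.pred p E := by
  have hnonneg := tentGlue_nonneg hf hh.1
  refine ⟨hnonneg, fun ζ hζ => ?_⟩
  by_cases hζα : ζ ∈ tentBoundary α
  · lift ζ to tentBoundary α using hζα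
    rw [one_le_potential_pred_iff hG hnonneg, deficit_tentGlue hG]
    simp_rw [Function.comp_def, tentGlue_apply, potential_const_mul (posPart_nonneg _)]
    exact (ENNReal.ofReal_le_ofReal (le_posPart _)).trans (le_mul_of_one_le_right' (hh.2 ζ hζ))
  · refine (hfE ζ ⟨hζ, hζα⟩).trans_eq (potential_congr fun i hi => ?_)
    exact (tentGlue_apply_of_not_le fun hαi => hζα (tentBoundary_subset hG hαi hi)).symm

theorem continuous_tentGlue (hG : G.IsTree) (α : Edge G o) (h : EdgeLp (TentEdge α) p) :
    Continuous fun f : EdgeLp (Edge G o) p => tentGlue α f h :=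
  (EdgeLp.continuous_glue (tentInclusion α)).comp <| continuous_id.prodMk <|
    (continuous_posPart.comp (continuous_deficit hG α.b)).smul continuous_const

theorem tentGlue_mem_closure (hG : G.IsTree) (hf : f ∈ closure (testFunctions Boundary.pred p E))
    (hh : h ∈ testFunctions (tentPred α) p ((↑) ⁻¹' E : Set (tentBoundary α))) :
    tentGlue α f h ∈ closure (testFunctions Boundary.pred p E) :=
  map_mem_closure (f := (tentGlue α · h)) (continuous_tentGlue hG α h) hf fun _ hg =>
    tentGlue_mem_testFunctions hG hg.1 (fun ζ hζ => hg.2 ζ hζ.1) hh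

end TentGlue

end Gluing

section EquilibriumFunction

variable {V : Type*} {G : SimpleGraph V} {o : V} {p : ℝ} [hp : Fact (1 < p)]
  {E : Set (Boundary G o)} {f : EdgeLp (Edge G o) p}

namespace IsEquilibriumFunction

theorem nonneg (hf : IsEquilibriumFunction Boundary.pred p E f) (i : Edge G o) : 0 ≤ f i :=
  nonneg_of_mem_closure hf.1 i

theorem norm_comap_le (hf : IsEquilibriumFunction Boundary.pred p E f) (hG : G.IsTree)
    {α : Edge G o} {h : EdgeLp (TentEdge α) p}
    (hh : h ∈ testFunctions (tentPred α) p ((↑) ⁻¹' E : Set (tentBoundary α))) :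
    ‖EdgeLp.comap (tentInclusion α) f‖ ≤ (deficit f α.b)⁺ * ‖h‖ := by
  have hle := hf.2.trans_le (capacity_le_of_mem_closure (tentGlue_mem_closure hG hf.1 hh))
  refine (EdgeLp.norm_comap_le_of_norm_le_norm_glue _ hle).trans_eq ?_
  rw [norm_smul, Real.norm_of_nonneg (posPart_nonneg _)]

theorem apply_le_posPart_deficit (hf : IsEquilibriumFunction Boundary.pred p E f) (hG : G.IsTree)
    (α : Edge G o) : f α ≤ (deficit f α.b)⁺ := by
  classical
  let root : TentEdge α := ⟨α, Edge.le_refl hG α⟩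
  have hle := hf.norm_comap_le hG (single_mem_testFunctions (P := tentPred α) (i := root)
    fun ζ _ => ζ.2)
  rw [lp.norm_single EdgeLp.exponent_pos, norm_one, mul_one] at hle
  calc f α ≤ ‖EdgeLp.comap (tentInclusion α) f root‖ := Real.le_norm_self _
    _ ≤ ‖EdgeLp.comap (tentInclusion α) f‖ :=
      lp.norm_apply_le_norm EdgeLp.exponent_pos.ne' _ root
    _ ≤ (deficit f α.b)⁺ := hle

theorem deficit_nonneg (hf : IsEquilibriumFunction Boundary.pred p E f) (hG : G.IsTree) (x : V) :
    0 ≤ deficit f x := by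
  induction x using vertex_induction (o := o) hG with
  | root => simp [deficit_root hG]
  | step β ih =>
    rw [deficit_e hG, sub_nonneg]
    exact (hf.apply_le_posPart_deficit hG β).trans_eq (posPart_of_nonneg ih)

theorem apply_le_deficit (hf : IsEquilibriumFunction Boundary.pred p E f) (hG : G.IsTree)
    (α : Edge G o) : f α ≤ deficit f α.b :=
  (hf.apply_le_posPart_deficit hG α).trans_eq (posPart_of_nonneg (hf.deficit_nonneg hG _))

theorem potential_pred_le_one (hf : IsEquilibriumFunction Boundary.pred p E f) (hG : G.IsTree)
    (ζ : Boundary G o) : potential ζ.pred f ≤ 1 := by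
  refine potential_le_of_forall_finset fun F hF => ?_
  obtain ⟨x, hFx, -⟩ := exists_vertexPred_between hG hF
  calc potential (F : Set (Edge G o)) f ≤ potential (vertexPred G o x) f := potential_mono hFx
    _ = ENNReal.ofReal (1 - deficit f x) := potential_vertexPred hG hf.nonneg x
    _ ≤ 1 := ENNReal.ofReal_le_one.2 (sub_le_self _ (hf.deficit_nonneg hG x))

end IsEquilibriumFunction

end EquilibriumFunction

/-! ### Restriction of equilibria to a tent -/

section Restriction

variable {V : Type*} {G : SimpleGraph V} {o : V} {p : ℝ} [hp : Fact (1 < p)] {α : Edge G o}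
  {f : EdgeLp (Edge G o) p} {E : Set (Boundary G o)}

/-- The restriction of an edge function to the tent `T_α`, normalized by its deficit at the root
`b(α)` of the tent. It is only meaningful when this deficit is positive. -/
noncomputable def tentRestrict (α : Edge G o) (f : EdgeLp (Edge G o) p) : EdgeLp (TentEdge α) p :=
  (deficit f α.b)⁻¹ • EdgeLp.comap (tentInclusion α) f

theorem potential_tentRestrict (hG : G.IsTree) (hf : ∀ i, 0 ≤ f i) (hpos : 0 < deficit f α.b)
    (ζ : tentBoundary α) : potential (tentPred α ζ) (tentRestrict α f) =
      (potential ζ.1.pred f - potential (vertexPred G o α.b) f) /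
        (1 - potential (vertexPred G o α.b) f) := by
  have hfinite : potential (vertexPred G o α.b) f ≠ ∞ := by
    rw [potential_vertexPred hG hf]
    exact ENNReal.ofReal_ne_top
  rw [potential_pred_eq hG ζ, ENNReal.add_sub_cancel_left hfinite,
    one_sub_potential_vertexPred hG hf, ENNReal.div_eq_inv_mul, ← ENNReal.ofReal_inv_of_pos hpos]
  exact potential_const_mul (inv_nonneg.2 hpos.le) _ _

theorem tentRestrict_mem_testFunctions (hG : G.IsTree) (hf : f ∈ testFunctions Boundary.pred p E)
    (hpos : 0 < deficit f α.b) :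
    tentRestrict α f ∈ testFunctions (tentPred α) p ((↑) ⁻¹' E : Set (tentBoundary α)) := by
  refine ⟨fun i => mul_nonneg (inv_nonneg.2 hpos.le) (hf.1 _), fun ζ hζ => ?_⟩
  rw [potential_tentRestrict hG hf.1 hpos, one_sub_potential_vertexPred hG hf.1,
    ENNReal.le_div_iff_mul_le (by simp [hpos]) (by simp), one_mul,
    ← one_sub_potential_vertexPred hG hf.1]
  exact tsub_le_tsub_right (hf.2 ζ hζ) _

theorem tentRestrict_mem_closure (hG : G.IsTree)
    (hf : f ∈ closure (testFunctions Boundary.pred p E)) (hpos : 0 < deficit f α.b) :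
    tentRestrict α f ∈
      closure (testFunctions (tentPred α) p ((↑) ⁻¹' E : Set (tentBoundary α))) := by
  have hdeficit := (continuous_deficit (p := p) hG α.b).continuousAt (x := f)
  have hcont : ContinuousAt (tentRestrict α) f :=
    (hdeficit.inv₀ hpos.ne').smul (EdgeLp.comap (tentInclusion α)).continuous.continuousAt
  have := mem_closure_iff_nhdsWithin_neBot.1 hf
  refine mem_closure_of_tendsto (b := nhdsWithin f (testFunctions Boundary.pred p E))
    (hcont.tendsto.mono_left nhdsWithin_le_nhds) ?_
  filter_upwards [nhdsWithin_le_nhds (hdeficit.eventually (lt_mem_nhds hpos)),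
    self_mem_nhdsWithin] with g hgpos hg
  exact tentRestrict_mem_testFunctions hG hg hgpos

theorem isEquilibriumFunction_tentRestrict (hG : G.IsTree)
    (hf : IsEquilibriumFunction Boundary.pred p E f) (hpos : 0 < deficit f α.b) :
    IsEquilibriumFunction (tentPred α) p ((↑) ⁻¹' E : Set (tentBoundary α))
      (tentRestrict α f) := by
  have hmem := tentRestrict_mem_closure hG hf.1 hpos
  refine ⟨hmem, le_antisymm (le_iInf₂ fun h hh => ?_) (capacity_le_of_mem_closure hmem)⟩
  refine ENNReal.rpow_le_rpow ?_ (zero_lt_one.trans hp.out).le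
  rw [enorm_le_iff_norm_le, tentRestrict, norm_smul, norm_inv,
    Real.norm_of_nonneg hpos.le, inv_mul_le_iff₀ hpos, ← posPart_of_nonneg hpos.le]
  exact hf.norm_comap_le hG hh

end Restriction

section EquilibriumMeasure

variable {V : Type*} {G : SimpleGraph V} {o : V} {p : ℝ} {α : Edge G o}
  {μ : Measure (Boundary G o)}

theorem ae_rescaledMeasure {q : Boundary G o → Prop} (hq : ∀ᵐ ζ ∂μ, q ζ) :
    ∀ᵐ ζ : tentBoundary α ∂rescaledMeasure p μ α, q ζ :=
  Measure.ae_smul_measure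
    ((ae_restrict_iff_subtype (measurableSet_tentBoundary α)).1 (ae_restrict_of_ae hq)) _

theorem edgeFunction_comap (hG : G.IsTree) (β : TentEdge α) :
    edgeFunction (tentPred α) p (μ.comap ((↑) : tentBoundary α → Boundary G o)) β =
      edgeFunction Boundary.pred p μ β.1 := by
  refine congrArg (ENNReal.toReal · ^ (p.conjExponent - 1)) ?_
  rw [comap_subtype_coe_apply (measurableSet_tentBoundary α)]
  exact congrArg μ ((Subtype.image_preimage_coe _ (tentBoundary β.1)).trans
    (Set.inter_eq_self_of_subset_right (tentBoundary_subset hG β.2)))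

theorem potentialAtBeginning_lt_one_iff (hG : G.IsTree) :
    potentialAtBeginning p μ α < 1 ↔ 0 < deficit (edgeFunction Boundary.pred p μ) α.b := by
  rw [potentialAtBeginning, ← tsub_pos_iff_lt,
    one_sub_potential_vertexPred hG fun i => edgeFunction_nonneg i, ENNReal.ofReal_pos]

variable [hp : Fact (1 < p)]

theorem rescalingConstant_eq (hG : G.IsTree) : rescalingConstant p μ α =
      (ENNReal.ofReal (deficit (edgeFunction Boundary.pred p μ) α.b) ^ (p - 1))⁻¹ := by
  rw [rescalingConstant, potentialAtBeginning,
    one_sub_potential_vertexPred hG fun i => edgeFunction_nonneg i,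
    holderConjugate_conjExponent.div_conj_eq_sub_one]

theorem rescalingConstant_ne_top (hG : G.IsTree)
    (hpos : 0 < deficit (edgeFunction Boundary.pred p μ) α.b) : rescalingConstant p μ α ≠ ∞ := by
  rw [rescalingConstant_eq hG, ENNReal.inv_ne_top]
  exact (ENNReal.rpow_pos (ENNReal.ofReal_pos.2 hpos) ENNReal.ofReal_ne_top).ne'

theorem edgeFunction_rescaledMeasure (hG : G.IsTree)
    (hpos : 0 < deficit (edgeFunction Boundary.pred p μ) α.b) (β : TentEdge α) :
    edgeFunction (tentPred α) p (rescaledMeasure p μ α) β =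
      (deficit (edgeFunction Boundary.pred p μ) α.b)⁻¹ * edgeFunction Boundary.pred p μ β.1 := by
  have hexponent : (p - 1) * (p.conjExponent - 1) = 1 := by
    linear_combination (holderConjugate_conjExponent (p := p)).mul_eq_add
  rw [rescaledMeasure, edgeFunction_smul, edgeFunction_comap hG, rescalingConstant_eq hG,
    ENNReal.toReal_inv, ← ENNReal.toReal_rpow, ENNReal.toReal_ofReal hpos.le,
    Real.inv_rpow (by positivity), ← Real.rpow_mul hpos.le, hexponent, Real.rpow_one]

section Equilibrium

variable [Countable V] [IsFiniteMeasure μ] {E : Set (Boundary G o)} {f : EdgeLp (Edge G o) p}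

/-- If the deficit vanished for the first time at the end of an edge `β`, then the equilibrium
function, hence also `μ`, would vanish beyond every successor of `β`; but `β` itself has positive
mass, since its deficit drops along `β`. -/
theorem IsEquilibriumFunction.deficit_b_pos (hf : IsEquilibriumFunction Boundary.pred p E f)
    (hG : G.IsTree) (hfμ : ⇑f = edgeFunction Boundary.pred p μ) (α : Edge G o) :
    0 < deficit f α.b := by
  have hnull (γ : Edge G o) : f γ = 0 ↔ μ (tentBoundary γ) = 0 := by
    rw [hfμ]
    exact edgeFunction_eq_zero_iff
  induction hα : α.b using vertex_induction (o := o) hG generalizing α with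
  | root => simp [deficit_root hG]
  | step β ih =>
    have hβ : 0 < deficit f β.b := ih β rfl
    refine (hf.deficit_nonneg hG β.e).lt_of_ne' fun hzero => ?_
    have hsucc (γ : Edge G o) (hγ : γ.b = β.e) : μ (tentBoundary γ) = 0 := by
      refine (hnull γ).1 (le_antisymm ?_ (hf.nonneg γ))
      rw [← hzero, ← hγ]
      exact hf.apply_le_deficit hG γ
    have hfβ : f β = 0 := (hnull β).2 <|
      measure_mono_null (tentBoundary_subset_iUnion_of_b_eq_e hG hα)
        (measure_iUnion_null fun γ => hsucc γ.1 γ.2)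
    rw [deficit_e hG, hfβ, sub_zero] at hzero
    exact hβ.ne' hzero

theorem IsEquilibriumFunction.ae_potential_eq_one
    (hf : IsEquilibriumFunction Boundary.pred p E f) (hG : G.IsTree)
    (hfμ : ⇑f = edgeFunction Boundary.pred p μ) (mass : μ Set.univ = capacity Boundary.pred p E) :
    ∀ᵐ ζ ∂μ, potential ζ.pred f = 1 := by
  have henergy : ∫⁻ ζ, potential ζ.pred f ∂μ = μ Set.univ := by
    rw [← enorm_rpow_eq_lintegral_potential measurableSet_tentBoundary hfμ, hf.2, mass]
  refine ae_eq_of_ae_le_of_lintegral_le (.of_forall fun ζ => hf.potential_pred_le_one hG ζ)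
    (henergy.trans_ne (measure_ne_top _ _)) aemeasurable_const ?_
  rw [lintegral_one, henergy]

end Equilibrium

theorem IsEquilibriumMeasure.deficit_pos [Countable V] {E : Set (Boundary G o)}
    (h : IsEquilibriumMeasure Boundary.pred p E μ) (hG : G.IsTree) (α : Edge G o) :
    0 < deficit (edgeFunction Boundary.pred p μ) α.b := by
  have := h.finite
  obtain ⟨f, hf, hfμ⟩ := h.equilibrium
  exact funext hfμ ▸ hf.deficit_b_pos hG (funext hfμ) α

theorem isEquilibriumMeasure_rescaledMeasure [Countable V] (hG : G.IsTree)
    {E : Set (Boundary G o)} (h : IsEquilibriumMeasure Boundary.pred p E μ) (α : Edge G o) :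
    IsEquilibriumMeasure (tentPred α) p ((↑) ⁻¹' E : Set (tentBoundary α))
      (rescaledMeasure p μ α) := by
  have := h.finite
  obtain ⟨f, hf, hfμ⟩ := h.equilibrium
  replace hfμ : ⇑f = edgeFunction Boundary.pred p μ := funext hfμ
  have hpos : 0 < deficit f α.b := hf.deficit_b_pos hG hfμ α
  have hfα := isEquilibriumFunction_tentRestrict hG hf hpos
  have hedge : ⇑(tentRestrict α f) = edgeFunction (tentPred α) p (rescaledMeasure p μ α) := by
    ext β
    rw [edgeFunction_rescaledMeasure hG (hfμ ▸ hpos), ← hfμ]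
    rfl
  have hfinite : IsFiniteMeasure (rescaledMeasure p μ α) :=
    Measure.smul_finite _ (rescalingConstant_ne_top hG (hfμ ▸ hpos))
  have hone : ∀ᵐ ζ ∂rescaledMeasure p μ α, potential (tentPred α ζ) (tentRestrict α f) = 1 := by
    filter_upwards [ae_rescaledMeasure (hf.ae_potential_eq_one hG hfμ h.mass)] with ζ hζ
    rw [potential_tentRestrict hG hf.nonneg hpos, hζ, one_sub_potential_vertexPred hG hf.nonneg]
    exact ENNReal.div_self (ENNReal.ofReal_pos.2 hpos).ne' ENNReal.ofReal_ne_top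
  refine ⟨hfinite, ?_, ⟨_, hfα, congrFun hedge⟩, ?_⟩
  · have hcarried : ∀ᵐ ζ ∂μ, ζ ∈ closure E := h.carried
    rw [← (isOpen_tentBoundary α).isOpenMap_subtype_val.preimage_closure_eq_closure_preimage
      continuous_subtype_val]
    exact ae_rescaledMeasure hcarried
  · have hmeas (β : TentEdge α) : MeasurableSet {ζ | β ∈ tentPred α ζ} :=
      measurable_subtype_coe (measurableSet_tentBoundary β.1)
    rw [← hfα.2]
    exact measure_univ_eq_enorm_rpow (P := tentPred α) hmeas hedge hone

end EquilibriumMeasure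

/-! ### Capacity of a set in a smaller tent -/

section CapacityTent

theorem exists_one_sub_rpow_mul_add_rpow_lt {p c : ℝ} (hp : 1 < p) (hc : 0 < c) :
    ∃ a, 0 ≤ a ∧ a < 1 ∧ (1 - a) ^ p * c + a ^ p < c := by
  have hp' : 0 < p - 1 := sub_pos.2 hp
  set t := c / (c + 1)
  have ht : 0 < t := by positivity
  have htc : t < c := div_lt_self hc (by linarith)
  have ht1 : t < 1 := (div_lt_one (by positivity)).2 (lt_add_one c)
  set a := t ^ (p - 1)⁻¹
  have ha : 0 < a := by positivity
  have ha1 : a < 1 := Real.rpow_lt_one ht.le ht1 (inv_pos.2 hp')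
  have hap : a ^ p = t * a := by
    rw [← Real.rpow_inv_rpow ht.le hp'.ne', ← Real.rpow_add_one ha.ne', sub_add_cancel]
  refine ⟨a, ha.le, ha1, ?_⟩
  calc (1 - a) ^ p * c + a ^ p ≤ (1 - a) * c + t * a := by
        rw [hap]
        gcongr
        exact Real.rpow_le_self_of_le_one (sub_nonneg.2 ha1.le) (sub_le_self _ ha.le) hp.le
    _ < (1 - a) * c + c * a := by gcongr
    _ = c := by ring

variable {V : Type*} {G : SimpleGraph V} {o : V} {p : ℝ} [hp : Fact (1 < p)] {α : Edge G o}
  {E : Set (Boundary G o)}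

theorem capacity_le_mul_capacity_tent_add (hG : G.IsTree) (hα : α.b ≠ o)
    (hEα : E ⊆ tentBoundary α) {a : ℝ} (ha : 0 ≤ a) (ha1 : a < 1) :
    capacity Boundary.pred p E ≤ ENNReal.ofReal ((1 - a) ^ p) *
      capacity (tentPred α) p ((↑) ⁻¹' E : Set (tentBoundary α)) + ENNReal.ofReal (a ^ p) := by
  classical
  have hp0 : 0 < p := zero_lt_one.trans hp.out
  obtain ⟨β, hβ⟩ := exists_edge_e_eq hG hα
  let f : EdgeLp (Edge G o) p := lp.single (ENNReal.ofReal p) β a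
  have hf : ∀ i, 0 ≤ f i := (Pi.single_nonneg (α := fun _ => ℝ) (i := β)).2 ha
  have hnorm : ‖f‖ = a := by
    rw [lp.norm_single EdgeLp.exponent_pos, Real.norm_of_nonneg ha]
  have hdeficit : (deficit f α.b)⁺ ≤ 1 - a := by
    have hfβ : f β = a := by simp [f]
    refine sup_le ?_ (sub_nonneg.2 ha1.le)
    rw [← hβ, deficit_e hG, hfβ]
    exact sub_le_sub_right (deficit_le_one hf _) a
  have hfactor : ENNReal.ofReal ((1 - a) ^ p) ≠ 0 :=
    (ENNReal.ofReal_pos.2 (Real.rpow_pos_of_pos (sub_pos.2 ha1) p)).ne'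
  rw [capacity, capacity]
  simp_rw [ENNReal.mul_iInf_of_ne hfactor ENNReal.ofReal_ne_top, ENNReal.iInf₂_add]
  refine le_iInf₂ fun h hh => ?_
  have hglue := tentGlue_mem_testFunctions hG hf (fun ζ hζ => absurd (hEα hζ.1) hζ.2) hh
  refine (iInf₂_le _ hglue).trans ((EdgeLp.enorm_glue_rpow_le ..).trans ?_)
  rw [enorm_smul, ENNReal.mul_rpow_of_nonneg _ _ hp0.le, EdgeLp.enorm_rpow_eq_ofReal f,
    EdgeLp.enorm_rpow_eq_ofReal (deficit f α.b)⁺, hnorm, Real.norm_of_nonneg (posPart_nonneg _)]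
  gcongr

theorem capacity_lt_capacity_tent (hG : G.IsTree) (hE : 0 < capacity Boundary.pred p E)
    (hα : α.b ≠ o) (hEα : E ⊆ tentBoundary α) :
    capacity Boundary.pred p E <
      capacity (tentPred α) p ((↑) ⁻¹' E : Set (tentBoundary α)) := by
  set c := capacity (tentPred α) p ((↑) ⁻¹' E : Set (tentBoundary α)) with hc
  have hbound {a : ℝ} (ha : 0 ≤ a) (ha1 : a < 1) :=
    capacity_le_mul_capacity_tent_add (p := p) hG hα hEα ha ha1
  have hfinite : c ≠ ∞ := by
    have hroot : c ≤ 1 := capacity_le_one (i := ⟨α, Edge.le_refl hG α⟩) fun ζ _ => ζ.2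
    exact ne_top_of_le_ne_top ENNReal.one_ne_top hroot
  have hpos : 0 < c := by
    refine hE.trans_le ?_
    simpa [Real.zero_rpow (zero_lt_one.trans hp.out).ne'] using hbound le_rfl zero_lt_one
  obtain ⟨a, ha, ha1, hlt⟩ :=
    exists_one_sub_rpow_mul_add_rpow_lt hp.out (ENNReal.toReal_pos hpos.ne' hfinite)
  have : 0 ≤ 1 - a := sub_nonneg.2 ha1.le
  refine (hbound ha ha1).trans_lt ?_
  rw [← hc, ← ENNReal.ofReal_toReal hfinite, ← ENNReal.ofReal_mul (by positivity),
    ← ENNReal.ofReal_add (by positivity) (by positivity)]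
  exact (ENNReal.ofReal_lt_ofReal_iff_of_nonneg (by positivity)).2 hlt

end CapacityTent

end TreeCapacity

theorem mainTheorem8_general {V : Type*} (G : SimpleGraph V) (o : V) (hG : G.IsTree)
    [Countable V] (p : ℝ) [Fact (1 < p)] :
    (∀ (E : Set (TreeCapacity.Boundary G o)) (μ : Measure (TreeCapacity.Boundary G o)),
      TreeCapacity.IsEquilibriumMeasure TreeCapacity.Boundary.pred p E μ →
      ∀ α : TreeCapacity.Edge G o,
        TreeCapacity.potentialAtBeginning p μ α < 1 ∧
        TreeCapacity.IsEquilibriumMeasure (TreeCapacity.tentPred α) p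
          ((↑) ⁻¹' E : Set (TreeCapacity.tentBoundary α))
          (TreeCapacity.rescaledMeasure p μ α) ∧
        (μ Eᶜ = 0 →
          μ.restrict (E ∩ TreeCapacity.tentBoundary α) =
            μ.restrict (TreeCapacity.tentBoundary α))) ∧
    (∀ E : Set (TreeCapacity.Boundary G o),
      0 < TreeCapacity.capacity TreeCapacity.Boundary.pred p E →
      ∀ α : TreeCapacity.Edge G o, α.b ≠ o → E ⊆ TreeCapacity.tentBoundary α →
        TreeCapacity.capacity TreeCapacity.Boundary.pred p E <
          TreeCapacity.capacity (TreeCapacity.tentPred α) p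
            ((↑) ⁻¹' E : Set (TreeCapacity.tentBoundary α))) := by
  refine ⟨fun E μ h α => ⟨?_, ?_, fun hE => ?_⟩, fun E hE α hα hEα => ?_⟩
  · exact (TreeCapacity.potentialAtBeginning_lt_one_iff hG).2 (h.deficit_pos hG α)
  · exact TreeCapacity.isEquilibriumMeasure_rescaledMeasure hG h α
  · exact Measure.restrict_congr_set (inter_ae_eq_right_of_ae_eq_univ (ae_eq_univ.2 hE))
  · exact TreeCapacity.capacity_lt_capacity_tent hG hE hα hEα

theorem mainTheorem8 {V : Type*} (G : SimpleGraph V) (o : V)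
    (hT : TreeCapacity.IsRootedTree G o) (p : ℝ) [Fact (1 < p)] :
    (∀ (E : Set (TreeCapacity.Boundary G o)) (μ : Measure (TreeCapacity.Boundary G o)),
      TreeCapacity.IsEquilibriumMeasure TreeCapacity.Boundary.pred p E μ →
      ∀ α : TreeCapacity.Edge G o,
        TreeCapacity.potentialAtBeginning p μ α < 1 ∧
        TreeCapacity.IsEquilibriumMeasure (TreeCapacity.tentPred α) p
          ((↑) ⁻¹' E : Set (TreeCapacity.tentBoundary α))
          (TreeCapacity.rescaledMeasure p μ α) ∧
        (μ Eᶜ = 0 →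
          μ.restrict (E ∩ TreeCapacity.tentBoundary α) =
            μ.restrict (TreeCapacity.tentBoundary α))) ∧
    (∀ E : Set (TreeCapacity.Boundary G o),
      0 < TreeCapacity.capacity TreeCapacity.Boundary.pred p E →
      ∀ α : TreeCapacity.Edge G o, α.b ≠ o → E ⊆ TreeCapacity.tentBoundary α →
        TreeCapacity.capacity TreeCapacity.Boundary.pred p E <
          TreeCapacity.capacity (TreeCapacity.tentPred α) p
            ((↑) ⁻¹' E : Set (TreeCapacity.tentBoundary α))) := by
  have := hT.countable
  exact mainTheorem8_general G o hT.isTree p
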